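/- Let $n\ge 2$, and let $X$ be either $\mathbb{R}^n$ (curvature $c=0$) with origin $o=0$ and Lebesgue measure, or the unit sphere $\mathbb{S}^n\subset\mathbb{R}^{n+1}$ (curvature $c=1$) with $o=e_{n+1}$ and surface measure; let $d$ be the geodesic distance of $X$, and put $s_0(t)=t$, $s_1(t)=\sin t$ (so $s_0'(t)=1$, $s_1'(t)=\cos t$). Let $\Xi_1$ be the set of complete one-dimensional totally geodesic submanifolds of $X$ (the lines of $\mathbb{R}^n$, resp. the great circles of $\mathbb{S}^n$). For $\xi\in\Xi_1$ let $d(o,\xi)=\inf_{x\in\xi}d(o,x)$, and let $$R_1f(\xi)=\int_\xi f\,d\ell$$ be the X-ray transform, where $\ell$ is arc length. For measurable $f:X\to\mathbb{C}$ let $f^*(t)=\inf\{s\ge 0:\ |\{x\in X:|f(x)|>s\}|\le t\}$ and $$\|f\|_{L^{n,1}(X)}=\frac1n\int_0^\infty t^{1/n}f^*(t)\,\frac{dt}{t}.$$ Then there is a constant $K$, depending only on $n$, such that for every radial function $f:X\to\mathbb{C}$ (that is, $f(x)$ depends only on $d(o,x)$) with $f\in L^{n,1}(X)$, the function $f$ is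 integrable over every $\xi\in\Xi_1$, and $$\sup_{\xi\in\Xi_1}\bigl|s_c'(d(o,\xi))\,R_1f(\xi)\bigr|\le K\,\|f\|_{L^{n,1}(X)}.$$ -/

import Mathlib

open MeasureTheory
open scoped ENNReal NNReal ContDiff

noncomputable section

/-- The curvature function `s_c`, i.e. the solution of `u'' + c u = 0`, `u 0 = 0`, `u' 0 = 1`. -/
def curvatureFn (c t : ℝ) : ℝ :=
  if c = 0 then t
  else if 0 < c then Real.sin (√c * t) / √c
  else Real.sinh (√(-c) * t) / √(-c)

/-- Decreasing rearrangement `f*(t) = inf {s ≥ 0 : μ {|f| > s} ≤ t}`. -/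
def decreasingRearrangement {X : Type*} [MeasurableSpace X] (f : X → ℂ) (μ : Measure X)
    (t : ℝ≥0∞) : ℝ≥0∞ :=
  sInf {s : ℝ≥0∞ | μ {x | s < ‖f x‖ₑ} ≤ t}

/-- The Lorentz quasi-norm
`‖f‖_{p,q} = ((q/p) ∫_0^∞ (t^{1/p} f*(t))^q dt/t)^{1/q}`, for `0 < p, q < ∞`. With this
normalization the indicator function of a set `A` has norm `μ(A)^{1/p}`. -/
def lorentzNorm {X : Type*} [MeasurableSpace X] (f : X → ℂ) (p q : ℝ) (μ : Measure X) : ℝ≥0∞ :=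
  (ENNReal.ofReal (q / p) * ∫⁻ t in Set.Ioi (0 : ℝ),
    (ENNReal.ofReal (t ^ (1 / p)) * decreasingRearrangement f μ (ENNReal.ofReal t)) ^ q /
      ENNReal.ofReal t) ^ (1 / q)

/-- Membership in the Lorentz space `L^{p,q}(μ)`. -/
def MemLorentz {X : Type*} [MeasurableSpace X] (f : X → ℂ) (p q : ℝ) (μ : Measure X) : Prop :=
  AEStronglyMeasurable f μ ∧ lorentzNorm f p q μ < ⊤

/-- `γ` is a complete unit-speed geodesic of the submanifold `X` of a Euclidean space `E`
(embedded by `ι : X → E`, with the induced Riemannian metric): the acceleration of `γ` is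
orthogonal at each point to `X`, i.e. to the velocities of all smooth curves of `X` through that
point. -/
def IsUnitSpeedGeodesic {X E : Type*} [NormedAddCommGroup E] [InnerProductSpace ℝ E]
    (ι : X → E) (γ : ℝ → X) : Prop :=
  ContDiff ℝ ∞ (ι ∘ γ) ∧
  (∀ t, ‖deriv (ι ∘ γ) t‖ = 1) ∧
  ∀ (t : ℝ) (σ : ℝ → X), ContDiff ℝ ∞ (ι ∘ σ) → σ 0 = γ t →
    inner ℝ (deriv (deriv (ι ∘ γ)) t) (deriv (ι ∘ σ) 0) = 0

/-- The set `Ξ_1` of (complete) one-dimensional totally geodesic submanifolds, i.e. of the point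
sets of the complete geodesics. -/
def geodesicLines {X E : Type*} [NormedAddCommGroup E] [InnerProductSpace ℝ E]
    (ι : X → E) : Set (Set X) :=
  {ξ | ∃ γ : ℝ → X, IsUnitSpeedGeodesic ι γ ∧ ξ = Set.range γ}

/-- The X-ray transform `R_1 f (ξ) = ∫_ξ f`. The measure on the curve `ξ` is arc length, which is
the one-dimensional Hausdorff measure (the same one for the chordal distance and for the
geodesic distance). -/
def xrayTransform {X : Type*} [MetricSpace X] [MeasurableSpace X] [BorelSpace X]
    (f : X → ℂ) (ξ : Set X) : ℂ :=
  ∫ x in ξ, f x ∂(Measure.hausdorffMeasure 1 : Measure X)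

/-- Distance from a point to a set, with respect to the distance function `d`. -/
def distToSet {X : Type*} (d : X → X → ℝ) (o : X) (ξ : Set X) : ℝ :=
  sInf (d o '' ξ)

/-- `f` is radial about `o`: `f x = g (s_c (d(o,x) / 2))` for some function `g`. -/
def IsRadialAbout {X : Type*} (c : ℝ) (d : X → X → ℝ) (o : X) (f : X → ℂ) : Prop :=
  ∃ g : ℝ → ℂ, ∀ x, f x = g (curvatureFn c (d o x / 2))

/-- The unit sphere `S^n` in `ℝ^{n+1}`. -/
abbrev UnitSphere (n : ℕ) : Type :=
  Metric.sphere (0 : EuclideanSpace ℝ (Fin (n + 1))) 1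

/-- The geodesic (great-circle) distance of the unit sphere. -/
def sphericalDist {n : ℕ} (x y : UnitSphere n) : ℝ :=
  InnerProductGeometry.angle (x : EuclideanSpace ℝ (Fin (n + 1)))
    (y : EuclideanSpace ℝ (Fin (n + 1)))

/-- The origin `e_{n+1}` of the sphere. -/
def northPole (n : ℕ) : UnitSphere n :=
  ⟨EuclideanSpace.single (Fin.last n) 1, by simp⟩

/-- The surface measure of the unit sphere. -/
def surfaceMeasure (n : ℕ) : Measure (UnitSphere n) :=
  (volume : Measure (EuclideanSpace ℝ (Fin (n + 1)))).toSphere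

end

/-! Everything reduces to one inequality for sets. By the layer-cake formula the integral of |f|
over ξ is the integral over s > 0 of the length of ξ ∩ {|f| > s}, while ‖f‖_{L^{n,1}} dominates the
integral over s of |{|f| > s}|^{1/n}. As f is radial, it suffices to bound the length of {x ∈ ξ :
d(o,x) ∈ E} by a constant times |{x : d(o,x) ∈ E}|^{1/n} for measurable E ⊆ ℝ
(`lintegral_enorm_le_lorentzNorm`, `lintegral_radial_le_lorentzNorm`).

Parametrize ξ by arc length t, starting at a point nearest to o. The distance to o is r = √(ρ² + t²)
on a line and satisfies cos r = k cos t on a great circle, with k = cos d(o,ξ). Hence r^{n-1} dr = t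
r^{n-2} dt ≥ t^{n-1} dt, respectively sin^{n-1} r dr = k sin t sin^{n-2} r dt ≥ k sin^{n-1} t dt. A
set T of parameters of given length has the least weight when it sits where t^{n-1} or sin^{n-1} t
is small, so |T|^n is at most a constant times its weight (`volume_preimage_sqrt_le`,
`volume_preimage_arccos_le`).

On the sphere this costs at most a factor 1/k, which the weight s_1'(d(o,ξ)) = k cancels. When k = 0
the function is constant on ξ, and only finiteness of the length matters. -/

/-! ### Lorentz norms and distribution functions -/

theorem lorentzNorm_one {X : Type*} [MeasurableSpace X] (f : X → ℂ) (p : ℝ) (μ : Measure X) :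
    lorentzNorm f p 1 μ = ENNReal.ofReal (1 / p) * ∫⁻ t in Set.Ioi (0 : ℝ),
      ENNReal.ofReal (t ^ (1 / p)) * decreasingRearrangement f μ (ENNReal.ofReal t) /
        ENNReal.ofReal t := by
  simp [lorentzNorm]

/-- Integrates (1/p) t^{1/p-1} over 0 < t < d. Since d may be infinite, the bound is checked against
every finite r < d^{1/p}, with D = r^p as endpoint. -/
theorem ENNReal.rpow_inv_le_setLIntegral {p : ℝ} (hp : 0 < p) (d : ℝ≥0∞) :
    d ^ (1 / p) ≤ ∫⁻ t in Set.Ioi (0 : ℝ), {t : ℝ | ENNReal.ofReal t < d}.indicator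
      (fun t => ENNReal.ofReal (1 / p) * (ENNReal.ofReal (t ^ (1 / p)) / ENNReal.ofReal t)) t := by
  refine ENNReal.le_of_forall_nnreal_lt fun r hr => ?_
  have hD : ((r ^ p : ℝ≥0) : ℝ≥0∞) < d := by
    have h := ENNReal.rpow_lt_rpow hr hp
    rwa [← ENNReal.rpow_mul, one_div_mul_cancel hp.ne', ENNReal.rpow_one,
      ENNReal.coe_rpow_of_nonneg _ hp.le] at *
  set D : ℝ := (r : ℝ) ^ p with hDdef
  have hD0 : 0 ≤ D := by positivity
  have hDe : ENNReal.ofReal D = ((r ^ p : ℝ≥0) : ℝ≥0∞) := by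
    rw [hDdef, ← NNReal.coe_rpow, ENNReal.ofReal_coe_nnreal]
  have hexp : -1 < 1 / p - 1 := by have := one_div_pos.2 hp; linarith
  calc (r : ℝ≥0∞) = ENNReal.ofReal (∫ t in (0 : ℝ)..D, (1 / p) * t ^ (1 / p - 1)) := by
        rw [intervalIntegral.integral_const_mul, integral_rpow (Or.inl hexp)]
        have h1 : D ^ (1 / p) = r := by
          rw [hDdef, ← Real.rpow_mul r.coe_nonneg, mul_one_div_cancel hp.ne', Real.rpow_one]
        rw [sub_add_cancel, Real.zero_rpow (one_div_pos.2 hp).ne', sub_zero, h1,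
          mul_div_cancel₀ _ (one_div_pos.2 hp).ne', ENNReal.ofReal_coe_nnreal]
    _ = ∫⁻ t in Set.Ioc 0 D, ENNReal.ofReal ((1 / p) * t ^ (1 / p - 1)) := by
        rw [intervalIntegral.integral_of_le hD0, ofReal_integral_eq_lintegral_ofReal]
        · have := (intervalIntegral.intervalIntegrable_rpow' (a := 0) (b := D) hexp).const_mul (1 / p)
          exact (intervalIntegrable_iff_integrableOn_Ioc_of_le hD0).1 this
        · filter_upwards [ae_restrict_mem measurableSet_Ioc] with t ht
          have := ht.1
          positivity
    _ ≤ _ := by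
        rw [← lintegral_indicator measurableSet_Ioc, ← lintegral_indicator measurableSet_Ioi]
        refine lintegral_mono fun t => ?_
        by_cases ht : t ∈ Set.Ioc 0 D
        · have h0 : 0 < t := ht.1
          have h2 : t ∈ {t : ℝ | ENNReal.ofReal t < d} :=
            lt_of_le_of_lt ((ENNReal.ofReal_le_ofReal ht.2).trans hDe.le) hD
          rw [Set.indicator_of_mem ht, Set.indicator_of_mem (show t ∈ Set.Ioi 0 from h0),
            Set.indicator_of_mem h2, ENNReal.ofReal_mul (by positivity),
            ← ENNReal.ofReal_div_of_pos h0, Real.rpow_sub_one h0.ne']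
        · rw [Set.indicator_of_notMem ht]
          exact zero_le

/-- Write d(s)^{1/p} as an integral over t < d(s) and exchange the integrals: for fixed t, the s > 0
with t < d(s) lie below f*(t), so they have length at most f*(t). -/
theorem lintegral_distribution_rpow_le_lorentzNorm {X : Type*} [MeasurableSpace X] (f : X → ℂ)
    {p : ℝ} (hp : 0 < p) (μ : Measure X) :
    ∫⁻ s in Set.Ioi (0 : ℝ), μ {x | s < ‖f x‖} ^ (1 / p) ≤ lorentzNorm f p 1 μ := by
  set d : ℝ → ℝ≥0∞ := fun s => μ {x | s < ‖f x‖}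
  have hd : Antitone d := fun s s' h => measure_mono fun x hx => lt_of_le_of_lt h hx
  set w : ℝ → ℝ≥0∞ := fun t =>
    ENNReal.ofReal (1 / p) * (ENNReal.ofReal (t ^ (1 / p)) / ENNReal.ofReal t)
  have hw : Measurable w := by fun_prop
  calc ∫⁻ s in Set.Ioi (0 : ℝ), d s ^ (1 / p)
      ≤ ∫⁻ s in Set.Ioi (0 : ℝ), ∫⁻ t in Set.Ioi (0 : ℝ),
          {t : ℝ | ENNReal.ofReal t < d s}.indicator w t :=
        lintegral_mono fun s => ENNReal.rpow_inv_le_setLIntegral hp _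
    _ = ∫⁻ t in Set.Ioi (0 : ℝ), ∫⁻ s in Set.Ioi (0 : ℝ),
          {t : ℝ | ENNReal.ofReal t < d s}.indicator w t := by
        refine lintegral_lintegral_swap (Measurable.aemeasurable ?_)
        have hS : MeasurableSet {q : ℝ × ℝ | ENNReal.ofReal q.2 < d q.1} :=
          measurableSet_lt (by fun_prop) (hd.measurable.comp measurable_fst)
        exact (hw.comp measurable_snd).indicator hS
    _ ≤ ∫⁻ t in Set.Ioi (0 : ℝ), w t * decreasingRearrangement f μ (ENNReal.ofReal t) := by
        refine lintegral_mono fun t => ?_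
        have hS : MeasurableSet {s : ℝ | ENNReal.ofReal t < d s} :=
          measurableSet_lt measurable_const hd.measurable
        calc ∫⁻ s in Set.Ioi (0 : ℝ), {t : ℝ | ENNReal.ofReal t < d s}.indicator w t
            = ∫⁻ s in Set.Ioi (0 : ℝ), {s : ℝ | ENNReal.ofReal t < d s}.indicator
                (fun _ => w t) s := rfl
          _ = w t * volume ({s : ℝ | ENNReal.ofReal t < d s} ∩ Set.Ioi 0) := by
              rw [lintegral_indicator_const hS, Measure.restrict_apply hS]
          _ ≤ _ := by
              gcongr
              refine le_sInf fun s hs => ?_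
              induction s with
              | top => exact le_top
              | coe s =>
                calc volume ({s : ℝ | ENNReal.ofReal t < d s} ∩ Set.Ioi 0)
                    ≤ volume (Set.Ioo (0 : ℝ) s) := by
                      refine measure_mono fun s' hs' => ⟨hs'.2, ?_⟩
                      by_contra! h
                      refine absurd hs'.1 (not_lt.2 ((measure_mono fun x hx => ?_).trans hs))
                      have h1 : (s : ℝ) < ‖f x‖ := lt_of_le_of_lt h hx
                      rw [Set.mem_ofPred_eq, enorm_eq_nnnorm]
                      exact_mod_cast h1
                  _ = s := by simp
    _ = lorentzNorm f p 1 μ := by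
        rw [lorentzNorm_one, ← lintegral_const_mul' _ _ ENNReal.ofReal_ne_top]
        refine lintegral_congr fun t => ?_
        simp only [w, div_eq_mul_inv]
        ring

/-- A restricted weak type hypothesis on sets yields an embedding of the Lorentz space `L^{p,1}`
into `L^1`. -/
theorem lintegral_enorm_le_lorentzNorm {Y : Type*} [MeasurableSpace Y] {F : Y → ℂ} {p : ℝ}
    (hp : 0 < p) {μ ν : Measure Y} {C : ℝ≥0∞} (hC : C ≠ ⊤)
    (h : ∀ E, MeasurableSet E → ν E ≤ C * μ E ^ (1 / p)) (hF : AEStronglyMeasurable F μ) :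
    AEStronglyMeasurable F ν ∧ ∫⁻ y, ‖F y‖ₑ ∂ν ≤ C * lorentzNorm F p 1 μ := by
  have hac : ν ≪ μ := Measure.AbsolutelyContinuous.mk fun E hE h0 => by
    have := h E hE
    rw [h0, ENNReal.zero_rpow_of_pos (one_div_pos.2 hp), mul_zero] at this
    exact le_antisymm this zero_le
  have hFν := hF.mono_ac hac
  -- Superlevel sets of an a.e. strongly measurable function are only null measurable, so the
  -- hypothesis is extended to those.
  have h' : ∀ E, NullMeasurableSet E μ → ν E ≤ C * μ E ^ (1 / p) := fun E hE => by
    obtain ⟨E', -, hE', he⟩ := hE.exists_measurable_superset_ae_eq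
    rw [← measure_congr he, ← measure_congr (hac.ae_eq he)]
    exact h E' hE'
  refine ⟨hFν, ?_⟩
  calc ∫⁻ y, ‖F y‖ₑ ∂ν = ∫⁻ y, ENNReal.ofReal ‖F y‖ ∂ν := by simp [ofReal_norm]
    _ = ∫⁻ s in Set.Ioi 0, ν {y | s < ‖F y‖} :=
        lintegral_eq_lintegral_meas_lt ν (.of_forall fun _ => norm_nonneg _) hFν.norm.aemeasurable
    _ ≤ ∫⁻ s in Set.Ioi 0, C * μ {y | s < ‖F y‖} ^ (1 / p) :=
        lintegral_mono fun s => h' _ (nullMeasurableSet_lt aemeasurable_const hF.norm.aemeasurable)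
    _ ≤ C * lorentzNorm F p 1 μ := by
        rw [lintegral_const_mul' _ _ hC]
        gcongr
        exact lintegral_distribution_rpow_le_lorentzNorm F hp μ

theorem lorentzNorm_congr_distribution {X Y : Type*} [MeasurableSpace X] [MeasurableSpace Y]
    {f : X → ℂ} {g : Y → ℂ} {μ : Measure X} {ν : Measure Y} (p q : ℝ)
    (h : ∀ s : ℝ≥0∞, μ {x | s < ‖f x‖ₑ} = ν {y | s < ‖g y‖ₑ}) :
    lorentzNorm f p q μ = lorentzNorm g p q ν := by
  simp only [lorentzNorm, decreasingRearrangement, h]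

/-! ### Polar coordinates on Euclidean space and on the sphere -/

/-- The measure with density `r ^ m` on the half-line. -/
noncomputable def radialPow (m : ℕ) : Measure ℝ :=
  (volume.restrict (Set.Ioi 0)).withDensity fun r => ENNReal.ofReal (r ^ m)

theorem measurePreserving_val_volumeIoiPow (m : ℕ) :
    MeasurePreserving (Subtype.val : Set.Ioi (0 : ℝ) → ℝ) (Measure.volumeIoiPow m)
      (radialPow m) := by
  refine ⟨measurable_subtype_coe, Measure.ext fun A hA => ?_⟩
  rw [Measure.map_apply measurable_subtype_coe hA, Measure.volumeIoiPow, radialPow,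
    withDensity_apply _ (measurable_subtype_coe hA), withDensity_apply _ hA,
    setLIntegral_subtype measurableSet_Ioi _ fun r : ℝ => ENNReal.ofReal (r ^ m),
    Measure.restrict_restrict hA, Subtype.image_preimage_coe, Set.inter_comm]

instance (m : ℕ) : SFinite (radialPow m) := by unfold radialPow; infer_instance

theorem measurePreserving_polar {E : Type*} [NormedAddCommGroup E] [NormedSpace ℝ E]
    [FiniteDimensional ℝ E] [Nontrivial E] [MeasurableSpace E] [BorelSpace E]
    (μ : Measure E) [μ.IsAddHaarMeasure] :
    MeasurePreserving (fun q : Metric.sphere (0 : E) 1 × ℝ => q.2 • (q.1 : E))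
      (μ.toSphere.prod (radialPow (Module.finrank ℝ E - 1))) μ := by
  have hm : Measurable (fun q : Metric.sphere (0 : E) 1 × ℝ => q.2 • (q.1 : E)) := by fun_prop
  refine ⟨hm, ?_⟩
  have h1 := (MeasurePreserving.id μ.toSphere).prod
    (measurePreserving_val_volumeIoiPow (Module.finrank ℝ E - 1))
  have h2 : MeasurePreserving (homeomorphUnitSphereProd E).symm
      (μ.toSphere.prod (Measure.volumeIoiPow (Module.finrank ℝ E - 1))) (μ.comap (↑)) :=
    MeasurePreserving.symm (homeomorphUnitSphereProd E).toMeasurableEquiv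
      μ.measurePreserving_homeomorphUnitSphereProd
  have h3 : MeasurePreserving (Subtype.val : ({0}ᶜ : Set E) → E) (μ.comap (↑))
      (μ.restrict {0}ᶜ) := measurePreserving_subtype_coe (measurableSet_singleton 0).compl
  have h4 := (h3.comp h2).map_eq
  rw [restrict_compl_singleton] at h4
  conv_rhs => rw [← h4]
  rw [← h1.map_eq, Measure.map_map hm h1.measurable]
  rfl

/-- The point of `ℝ^{n+1} = ℝ^n × ℝ` with the given components. -/
noncomputable def euclideanSnoc {n : ℕ} (q : EuclideanSpace ℝ (Fin n) × ℝ) : EuclideanSpace ℝ (Fin (n + 1)) :=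
  WithLp.toLp 2 ((MeasurableEquiv.piFinSuccAbove (fun _ => ℝ) (Fin.last n)).symm
    (q.2, WithLp.ofLp q.1))

theorem measurePreserving_euclideanSnoc (n : ℕ) :
    MeasurePreserving (euclideanSnoc (n := n)) :=
  (PiLp.volume_preserving_toLp (Fin (n + 1))).comp
    ((MeasurePreserving.symm _ (volume_preserving_piFinSuccAbove (fun _ => ℝ) (Fin.last n))).comp
      (Measure.measurePreserving_swap.comp
        ((PiLp.volume_preserving_ofLp (Fin n)).prod (MeasurePreserving.id volume))))

theorem euclideanSnoc_last {n : ℕ} (q : EuclideanSpace ℝ (Fin n) × ℝ) :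
    euclideanSnoc q (Fin.last n) = q.2 := by
  simp [euclideanSnoc, MeasurableEquiv.piFinSuccAbove, Fin.insertNthEquiv]

theorem euclideanSnoc_castSucc {n : ℕ} (q : EuclideanSpace ℝ (Fin n) × ℝ) (i : Fin n) :
    euclideanSnoc q i.castSucc = q.1 i := by
  simp [euclideanSnoc, MeasurableEquiv.piFinSuccAbove, Fin.insertNthEquiv]

theorem euclideanSnoc_smul {n : ℕ} (r : ℝ) (q : EuclideanSpace ℝ (Fin n) × ℝ) :
    euclideanSnoc (r • q) = r • euclideanSnoc q := by
  ext i
  refine Fin.lastCases ?_ (fun i => ?_) i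
  · simp [euclideanSnoc_last]
  · simp [euclideanSnoc_castSucc]

theorem norm_euclideanSnoc_sq {n : ℕ} (q : EuclideanSpace ℝ (Fin n) × ℝ) :
    ‖euclideanSnoc q‖ ^ 2 = ‖q.1‖ ^ 2 + q.2 ^ 2 := by
  simp [EuclideanSpace.norm_sq_eq, Fin.sum_univ_castSucc, euclideanSnoc_last,
    euclideanSnoc_castSucc]

/-- Spherical coordinates: the point at distance `θ` from the north pole in the direction `ω`. -/
noncomputable def sphericalPoint {n : ℕ} (q : Metric.sphere (0 : EuclideanSpace ℝ (Fin n)) 1 × ℝ) :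
    UnitSphere n :=
  ⟨euclideanSnoc (Real.sin q.2 • (q.1 : EuclideanSpace ℝ (Fin n)), Real.cos q.2), by
    have h : ‖euclideanSnoc (Real.sin q.2 • (q.1 : EuclideanSpace ℝ (Fin n)), Real.cos q.2)‖ ^ 2
        = 1 := by
      simp [norm_euclideanSnoc_sq, norm_smul]
    exact mem_sphere_zero_iff_norm.2 ((pow_eq_one_iff_of_nonneg (norm_nonneg _) two_ne_zero).1 h)⟩

theorem measurable_sphericalPoint (n : ℕ) : Measurable (sphericalPoint (n := n)) := by
  refine Measurable.subtype_mk ((measurePreserving_euclideanSnoc n).measurable.comp ?_)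
  fun_prop

theorem sphericalDist_northPole {n : ℕ} (x : UnitSphere n) :
    sphericalDist (northPole n) x
      = Real.arccos ((x : EuclideanSpace ℝ (Fin (n + 1))) (Fin.last n)) := by
  simp [sphericalDist, InnerProductGeometry.angle, northPole, EuclideanSpace.inner_single_left]

theorem sphericalDist_northPole_sphericalPoint {n : ℕ}
    (q : Metric.sphere (0 : EuclideanSpace ℝ (Fin n)) 1 × ℝ) (h : q.2 ∈ Set.Icc 0 Real.pi) :
    sphericalDist (northPole n) (sphericalPoint q) = q.2 := by
  rw [sphericalDist_northPole, sphericalPoint, euclideanSnoc_last, Real.arccos_cos h.1 h.2]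

theorem measurableSet_Ioo_smul_sphere {E : Type*} [NormedAddCommGroup E] [NormedSpace ℝ E]
    [MeasurableSpace E] [BorelSpace E] {B : Set (Metric.sphere (0 : E) 1)}
    (hB : MeasurableSet B) :
    MeasurableSet {x : E | ∃ r ∈ Set.Ioo (0 : ℝ) 1, ∃ b ∈ B, r • (b : E) = x} := by
  have h : MeasurableEmbedding (Subtype.val ∘ (homeomorphUnitSphereProd E).symm) :=
    (MeasurableEmbedding.subtype_coe (measurableSet_singleton _).compl).comp
      (Homeomorph.measurableEmbedding _)
  convert h.measurableSet_image.2 (hB.prod (measurableSet_Iio (a := ⟨1, Set.mem_Ioi.2 one_pos⟩)))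
  ext x
  constructor
  · rintro ⟨r, hr, b, hb, rfl⟩
    exact ⟨(b, ⟨r, hr.1⟩), ⟨hb, hr.2⟩, rfl⟩
  · rintro ⟨⟨b, r⟩, ⟨hb, hr⟩, rfl⟩
    exact ⟨r, ⟨r.2, hr⟩, b, hb, rfl⟩

/-- The measure with density `sin θ ^ m` on `(0, π)`. -/
noncomputable def sinPow (m : ℕ) : Measure ℝ :=
  (volume.restrict (Set.Ioo 0 Real.pi)).withDensity fun θ => ENNReal.ofReal (Real.sin θ ^ m)

instance (m : ℕ) : SFinite (sinPow m) := by unfold sinPow; infer_instance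

theorem lintegral_radialPow (m : ℕ) {G : ℝ → ℝ≥0∞} (hG : Measurable G) :
    ∫⁻ r, G r ∂radialPow m = ∫⁻ r in Set.Ioi 0, ENNReal.ofReal (r ^ m) * G r := by
  rw [radialPow, lintegral_withDensity_eq_lintegral_mul _ (by fun_prop) hG]
  rfl

theorem lintegral_sinPow (m : ℕ) {G : ℝ → ℝ≥0∞} (hG : Measurable G) :
    ∫⁻ r, G r ∂sinPow m =
      ∫⁻ θ in Set.Ioo 0 Real.pi, ENNReal.ofReal (Real.sin θ ^ m) * G θ := by
  rw [sinPow, lintegral_withDensity_eq_lintegral_mul _ (by fun_prop) hG]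
  rfl

theorem lintegral_Ioo_zero_one_pow (m : ℕ) :
    ∫⁻ r in Set.Ioo (0 : ℝ) 1, ENNReal.ofReal (r ^ m) = ENNReal.ofReal (1 / (m + 1)) := by
  rw [restrict_Ioo_eq_restrict_Ioc, ← ofReal_integral_eq_lintegral_ofReal,
    ← intervalIntegral.integral_of_le zero_le_one, integral_pow]
  · simp
  · exact (intervalIntegral.intervalIntegrable_pow m).1
  · filter_upwards [ae_restrict_mem measurableSet_Ioc] with r hr
    exact pow_nonneg hr.1.le m

/-- Integration in polar coordinates over the half disc of a function of the angle. -/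
theorem lintegral_halfDisc (m : ℕ) {G : ℝ × ℝ → ℝ≥0∞} (hG : Measurable G) {χ : ℝ → ℝ≥0∞}
    (hχ : Measurable χ)
    (h : ∀ r > 0, ∀ θ, G (r * Real.cos θ, r * Real.sin θ) = if r < 1 then χ θ else 0) :
    ∫⁻ ρ, (∫⁻ t, G (t, ρ)) ∂radialPow m
      = ENNReal.ofReal (1 / (m + 2)) * ∫⁻ θ, χ θ ∂sinPow m := by
  set H : ℝ × ℝ → ℝ≥0∞ := fun p =>
    (Set.Ioi (0 : ℝ)).indicator (fun ρ => ENNReal.ofReal (ρ ^ m)) p.2 * G p with hHdef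
  have hH : Measurable H := by
    refine Measurable.mul ?_ hG
    exact (Measurable.indicator (by fun_prop) measurableSet_Ioi).comp measurable_snd
  calc ∫⁻ ρ, (∫⁻ t, G (t, ρ)) ∂radialPow m
      = ∫⁻ ρ, ∫⁻ t, H (t, ρ) := by
        rw [lintegral_radialPow _ (Measurable.lintegral_prod_left' hG),
          ← lintegral_indicator measurableSet_Ioi]
        refine lintegral_congr fun ρ => ?_
        by_cases hρ : ρ ∈ Set.Ioi (0 : ℝ)
        · simp only [hHdef, Set.indicator_of_mem hρ]
          rw [lintegral_const_mul' _ _ ENNReal.ofReal_ne_top]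
        · simp [hHdef, Set.indicator_of_notMem hρ]
    _ = ∫⁻ p : ℝ × ℝ, H p := by
        rw [Measure.volume_eq_prod, lintegral_prod_symm _ hH.aemeasurable]
    _ = ∫⁻ p : ℝ × ℝ in polarCoord.target, ENNReal.ofReal p.1 • H (polarCoord.symm p) :=
        (lintegral_comp_polarCoord_symm H).symm
    -- The Jacobian raises r^m to r^(m+1). Angles in (-π, 0] drop out because there ρ = r sin θ ≤ 0.
    _ = ∫⁻ p : ℝ × ℝ, (Set.Ioo (0 : ℝ) 1).indicator (fun r => ENNReal.ofReal (r ^ (m + 1))) p.1 *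
          (Set.Ioo 0 Real.pi).indicator
            (fun θ => ENNReal.ofReal (Real.sin θ ^ m) * χ θ) p.2 := by
        rw [← lintegral_indicator polarCoord.open_target.measurableSet]
        refine lintegral_congr fun p => ?_
        obtain ⟨r, θ⟩ := p
        rw [polarCoord_target, Set.indicator_apply]
        simp only [polarCoord_symm_apply, smul_eq_mul, hHdef]
        split_ifs with hp
        · obtain ⟨hr, hθ⟩ := hp
          simp only [Set.mem_Ioi] at hr
          rw [h r hr θ]
          by_cases h0 : 0 < θ
          · have hs : 0 < Real.sin θ := Real.sin_pos_of_pos_of_lt_pi h0 hθ.2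
            have h1 : r * Real.sin θ ∈ Set.Ioi (0 : ℝ) := mul_pos hr hs
            rw [Set.indicator_of_mem h1,
              Set.indicator_of_mem (show θ ∈ Set.Ioo 0 Real.pi from ⟨h0, hθ.2⟩)]
            by_cases hr1 : r < 1
            · rw [if_pos hr1, Set.indicator_of_mem (show r ∈ Set.Ioo (0 : ℝ) 1 from ⟨hr, hr1⟩),
                mul_pow, pow_succ, ENNReal.ofReal_mul (by positivity),
                ENNReal.ofReal_mul (by positivity)]
              ring
            · rw [if_neg hr1,
                Set.indicator_of_notMem (show r ∉ Set.Ioo (0 : ℝ) 1 from fun h => hr1 h.2)]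
              simp
          · have hs : Real.sin θ ≤ 0 :=
              Real.sin_nonpos_of_nonpos_of_neg_pi_le (not_lt.1 h0) hθ.1.le
            have h1 : r * Real.sin θ ∉ Set.Ioi (0 : ℝ) :=
              not_lt.2 (mul_nonpos_of_nonneg_of_nonpos hr.le hs)
            rw [Set.indicator_of_notMem h1,
              Set.indicator_of_notMem (show θ ∉ Set.Ioo 0 Real.pi from fun h => h0 h.1)]
            simp
        · by_cases hr : r ∈ Set.Ioo (0 : ℝ) 1
          · have hθ : θ ∉ Set.Ioo 0 Real.pi := fun hθ =>
              hp ⟨hr.1, by have := hθ.1; have := Real.pi_pos; linarith, hθ.2⟩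
            rw [Set.indicator_of_notMem hθ, mul_zero]
          · rw [Set.indicator_of_notMem hr, zero_mul]
    _ = _ := by
        rw [Measure.volume_eq_prod, lintegral_prod_mul
          (f := (Set.Ioo (0 : ℝ) 1).indicator (fun r => ENNReal.ofReal (r ^ (m + 1))))
          (g := (Set.Ioo 0 Real.pi).indicator
            (fun θ => ENNReal.ofReal (Real.sin θ ^ m) * χ θ))
          (Measurable.indicator (by fun_prop) measurableSet_Ioo).aemeasurable
          (Measurable.indicator (by fun_prop) measurableSet_Ioo).aemeasurable,
          lintegral_indicator measurableSet_Ioo, lintegral_indicator measurableSet_Ioo,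
          lintegral_Ioo_zero_one_pow, lintegral_sinPow _ hχ]
        push_cast
        ring_nf

theorem smul_sphere_mem_cone_iff {E : Type*} [NormedAddCommGroup E] [NormedSpace ℝ E]
    {B : Set (Metric.sphere (0 : E) 1)} {r : ℝ} (hr : 0 < r) (b : Metric.sphere (0 : E) 1) :
    r • (b : E) ∈ {x : E | ∃ r ∈ Set.Ioo (0 : ℝ) 1, ∃ b ∈ B, r • (b : E) = x} ↔
      r < 1 ∧ b ∈ B := by
  constructor
  · rintro ⟨r', hr', b', hb', h⟩
    have h1 := congrArg norm h
    simp only [norm_smul, norm_eq_of_mem_sphere, mul_one, Real.norm_eq_abs, abs_of_pos hr,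
      abs_of_pos hr'.1] at h1
    subst h1
    have h2 : b' = b := Subtype.ext (smul_right_injective E hr.ne' h)
    exact ⟨hr'.2, h2 ▸ hb'⟩
  · rintro ⟨h1, hb⟩
    exact ⟨r, ⟨hr, h1⟩, b, hb, rfl⟩

open scoped Pointwise in
-- The surface measure of B is n + 1 times the volume of the cone C over B. That volume is computed
-- by splitting off the last coordinate, using polar coordinates in the first n, and then polar
-- coordinates in the half plane (height, radius); the radial integral gives 1/(n + 1), which
-- cancels.
theorem measurePreserving_sphericalPoint {n : ℕ} (hn : 1 ≤ n) :
    MeasurePreserving (sphericalPoint (n := n))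
      ((volume : Measure (EuclideanSpace ℝ (Fin n))).toSphere.prod (sinPow (n - 1)))
      (surfaceMeasure n) := by
  have : Nonempty (Fin n) := ⟨⟨0, hn⟩⟩
  refine ⟨measurable_sphericalPoint n, Measure.ext fun B hB => ?_⟩
  set C : Set (EuclideanSpace ℝ (Fin (n + 1))) :=
    {x | ∃ r ∈ Set.Ioo (0 : ℝ) 1, ∃ b ∈ B, r • (b : EuclideanSpace ℝ (Fin (n + 1))) = x}
    with hCdef
  have hC : MeasurableSet C := measurableSet_Ioo_smul_sphere hB
  have hC' : Set.Ioo (0 : ℝ) 1 • (Subtype.val '' B) = C := by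
    ext x
    simp [Set.mem_smul, hCdef]
  have h1 := (measurePreserving_euclideanSnoc n).comp
    ((measurePreserving_polar (volume : Measure (EuclideanSpace ℝ (Fin n)))).prod
      (MeasurePreserving.id (volume : Measure ℝ)))
  rw [finrank_euclideanSpace_fin] at h1
  have hS : MeasurableSet (sphericalPoint (n := n) ⁻¹' B) := measurable_sphericalPoint n hB
  have key : volume C = ENNReal.ofReal (1 / ((n - 1 : ℕ) + 2)) *
      ((volume : Measure (EuclideanSpace ℝ (Fin n))).toSphere.prod (sinPow (n - 1)))
        (sphericalPoint ⁻¹' B) := by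
    rw [← h1.measure_preimage hC.nullMeasurableSet, ← lintegral_indicator_one (h1.measurable hC),
      lintegral_prod _ ((measurable_one.indicator (h1.measurable hC)).aemeasurable),
      lintegral_prod _ ((measurable_one.indicator
        (h1.measurable hC)).lintegral_prod_right').aemeasurable,
      ← lintegral_indicator_one hS, lintegral_prod _ (measurable_one.indicator hS).aemeasurable,
      ← lintegral_const_mul' _ _ ENNReal.ofReal_ne_top]
    refine lintegral_congr fun b => ?_
    refine lintegral_halfDisc (n - 1)
      (G := fun p => Set.indicator _ (1 : (_ × ℝ) × ℝ → ℝ≥0∞) ((b, p.2), p.1))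
      ((measurable_one.indicator (h1.measurable hC)).comp (by fun_prop))
      ((measurable_one.indicator hS).comp (by fun_prop)) fun r hr θ => ?_
    have h2 : euclideanSnoc ((r * Real.sin θ) • (b : EuclideanSpace ℝ (Fin n)), r * Real.cos θ)
        = r • (sphericalPoint (b, θ) : EuclideanSpace ℝ (Fin (n + 1))) := by
      rw [sphericalPoint, ← euclideanSnoc_smul]
      simp [mul_smul]
    have h3 : ((b, r * Real.sin θ), r * Real.cos θ) ∈
        (euclideanSnoc ∘ Prod.map (fun q : Metric.sphere (0 : EuclideanSpace ℝ (Fin n)) 1 × ℝ =>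
          q.2 • (q.1 : EuclideanSpace ℝ (Fin n))) id) ⁻¹' C ↔
        r < 1 ∧ (b, θ) ∈ sphericalPoint ⁻¹' B := by
      rw [Set.mem_preimage, Function.comp_apply, Prod.map_apply, id_eq, h2]
      exact smul_sphere_mem_cone_iff hr (sphericalPoint (b, θ))
    by_cases hr1 : r < 1
    · rw [if_pos hr1]
      by_cases hb : (b, θ) ∈ sphericalPoint ⁻¹' B
      · exact (Set.indicator_of_mem (h3.2 ⟨hr1, hb⟩) _).trans
          (Set.indicator_of_mem hb fun _ => (1 : ℝ≥0∞)).symm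
      · exact (Set.indicator_of_notMem (fun h => hb (h3.1 h).2) _).trans
          (Set.indicator_of_notMem hb _).symm
    · rw [if_neg hr1]
      exact Set.indicator_of_notMem (fun h => hr1 (h3.1 h).1) _
  rw [Measure.map_apply (measurable_sphericalPoint n) hB, surfaceMeasure,
    Measure.toSphere_apply' _ hB, hC', key, finrank_euclideanSpace_fin, ← mul_assoc]
  have h4 : (((n - 1 : ℕ) : ℝ) + 2) = ((n + 1 : ℕ) : ℝ) := by
    rw [Nat.cast_sub hn]; push_cast; ring
  rw [h4, ← ENNReal.ofReal_natCast, ← ENNReal.ofReal_mul (by positivity),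
    mul_one_div_cancel (by positivity), ENNReal.ofReal_one, one_mul]

/-! ### Length of a set against its weighted measure -/

theorem ENNReal.le_mul_rpow_of_pow_le {n : ℕ} (hn : n ≠ 0) {x c y : ℝ≥0∞}
    (h : x ^ n ≤ c ^ n * y) : x ≤ c * y ^ (1 / (n : ℝ)) := by
  have h1 := ENNReal.rpow_le_rpow h (z := 1 / (n : ℝ)) (by positivity)
  rw [ENNReal.mul_rpow_of_nonneg _ _ (by positivity), one_div, ENNReal.pow_rpow_inv_natCast hn,
    ENNReal.pow_rpow_inv_natCast hn] at h1
  rwa [one_div]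

theorem mul_measure_sub_le_setLIntegral {X : Type*} [MeasurableSpace X] {μ : Measure X}
    {T A : Set X} (hT : MeasurableSet T) (hA : MeasurableSet A) {w : X → ℝ≥0∞} {c : ℝ≥0∞}
    (h : ∀ t ∈ T \ A, c ≤ w t) : c * (μ T - μ A) ≤ ∫⁻ t in T, w t ∂μ :=
  calc c * (μ T - μ A) ≤ c * μ (T \ A) := by gcongr; exact le_measure_sdiff
    _ = ∫⁻ _ in T \ A, c ∂μ := (setLIntegral_const _ _).symm
    _ ≤ ∫⁻ t in T \ A, w t ∂μ := setLIntegral_mono' (MeasurableSet.diff hT hA) h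
    _ ≤ ∫⁻ t in T, w t ∂μ := lintegral_mono_set Set.sdiff_subset

theorem volume_le_two_mul_of_neg_mem {S : Set ℝ} (hS : ∀ t ∈ S, -t ∈ S) :
    volume S ≤ 2 * volume (S ∩ Set.Ioi 0) := by
  have h : S ⊆ (S ∩ Set.Ioi 0) ∪ ((fun t => -t) ⁻¹' (S ∩ Set.Ioi 0) ∪ {0}) := by
    intro t ht
    rcases lt_trichotomy t 0 with h | h | h
    · exact Or.inr (Or.inl ⟨hS t ht, neg_pos.2 h⟩)
    · exact Or.inr (Or.inr h)
    · exact Or.inl ⟨ht, h⟩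
  calc volume S ≤ volume (S ∩ Set.Ioi 0) +
        (volume ((fun t => -t) ⁻¹' (S ∩ Set.Ioi 0)) + volume ({0} : Set ℝ)) :=
        (measure_mono h).trans ((measure_union_le _ _).trans
          (add_le_add_right (measure_union_le _ _) _))
    _ = 2 * volume (S ∩ Set.Ioi 0) := by
        rw [Measure.measure_preimage_neg, Real.volume_singleton, add_zero, two_mul]

/-- For x < |T|, discarding (0, x/2) leaves measure at least x/2, on which the weight is at least
(x/2)^m. Using x instead of |T| covers sets of infinite length. -/
theorem volume_pow_le_setLIntegral_pow {T : Set ℝ} (hT : MeasurableSet T) (h0 : T ⊆ Set.Ioi 0)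
    (m : ℕ) : volume T ^ (m + 1) ≤ 2 ^ (m + 1) * ∫⁻ t in T, ENNReal.ofReal (t ^ m) := by
  rw [← ENNReal.rpow_natCast]
  refine (ENNReal.le_rpow_inv_iff (by positivity)).1 (ENNReal.le_of_forall_nnreal_lt fun x hx => ?_)
  rw [ENNReal.le_rpow_inv_iff (by positivity), ENNReal.rpow_natCast]
  have h := mul_measure_sub_le_setLIntegral (μ := volume) hT
    (measurableSet_Ioo (a := (0 : ℝ)) (b := x / 2))
    (w := fun t => ENNReal.ofReal (t ^ m)) (c := ENNReal.ofReal ((x / 2 : ℝ) ^ m)) fun t ht => by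
      have h1 : (x : ℝ) / 2 ≤ t := not_lt.1 fun h => ht.2 ⟨h0 ht.1, h⟩
      gcongr
  have h2 : ENNReal.ofReal (x / 2) ≤ volume T - volume (Set.Ioo (0 : ℝ) (x / 2)) := by
    refine ENNReal.le_sub_of_add_le_left (by simp) ?_
    rw [Real.volume_Ioo, sub_zero, ← ENNReal.ofReal_add (by positivity) (by positivity), add_halves,
      ENNReal.ofReal_coe_nnreal]
    exact hx.le
  calc (x : ℝ≥0∞) ^ (m + 1)
      = 2 ^ (m + 1) * (ENNReal.ofReal ((x / 2 : ℝ) ^ m) * ENNReal.ofReal (x / 2)) := by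
        rw [← ENNReal.ofReal_mul (by positivity), ← pow_succ, ENNReal.ofReal_pow (by positivity),
          ← mul_pow, ← ENNReal.ofReal_ofNat, ← ENNReal.ofReal_mul (by positivity),
          mul_div_cancel₀ _ two_ne_zero, ENNReal.ofReal_coe_nnreal]
    _ ≤ _ := by
        gcongr
        exact (mul_le_mul_right h2 _).trans h

/-- With x = |T|, discard pieces of length x/4 at both ends of (0, π). On the remainder, of measure
at least x/2, Jordan's inequality gives sin t ≥ (2/π)(x/4) = x/(2π). -/
theorem volume_pow_le_setLIntegral_sin_pow {T : Set ℝ} (hT : MeasurableSet T)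
    (h0 : T ⊆ Set.Ioo 0 Real.pi) (m : ℕ) :
    volume T ^ (m + 1) ≤ ENNReal.ofReal (2 * Real.pi) ^ (m + 1) *
      ∫⁻ t in T, ENNReal.ofReal (Real.sin t ^ m) := by
  have hpi := Real.pi_pos
  have hle : volume T ≤ ENNReal.ofReal Real.pi := by
    simpa using measure_mono (μ := volume) h0
  obtain ⟨x, hx⟩ : ∃ x : ℝ≥0, volume T = x :=
    ⟨_, (ENNReal.coe_toNNReal (ne_top_of_le_ne_top ENNReal.ofReal_ne_top hle)).symm⟩
  have hxpi : (x : ℝ) ≤ Real.pi := by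
    rw [hx, ← ENNReal.ofReal_coe_nnreal] at hle
    exact (ENNReal.ofReal_le_ofReal_iff hpi.le).1 hle
  have hx0 : (0 : ℝ) ≤ x := x.2
  set A : Set ℝ := Set.Ioo (0 : ℝ) (x / 4) ∪ Set.Ioo (Real.pi - x / 4) Real.pi
  have h := mul_measure_sub_le_setLIntegral (μ := volume) hT
    (measurableSet_Ioo.union measurableSet_Ioo : MeasurableSet A)
    (w := fun t => ENNReal.ofReal (Real.sin t ^ m))
    (c := ENNReal.ofReal ((x / (2 * Real.pi) : ℝ) ^ m)) fun t ht => by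
      have h1 : (x : ℝ) / 4 ≤ t := not_lt.1 fun h => ht.2 (Or.inl ⟨(h0 ht.1).1, h⟩)
      have h2 : t ≤ Real.pi - x / 4 := not_lt.1 fun h => ht.2 (Or.inr ⟨h, (h0 ht.1).2⟩)
      have h3 : ∀ s : ℝ, (x : ℝ) / 4 ≤ s → s ≤ Real.pi / 2 → x / (2 * Real.pi) ≤ Real.sin s :=
        fun s hs hs' => by
          refine le_trans ?_ (Real.mul_le_sin (by linarith) hs')
          calc (x : ℝ) / (2 * Real.pi) = 2 / Real.pi * (x / 4) := by field_simp; norm_num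
            _ ≤ _ := by gcongr
      have h4 : x / (2 * Real.pi) ≤ Real.sin t := by
        rcases le_total t (Real.pi / 2) with h5 | h5
        · exact h3 t h1 h5
        · rw [← Real.sin_pi_sub]
          exact h3 _ (by linarith) (by linarith)
      gcongr
  have h2 : ENNReal.ofReal (x / 2) ≤ volume T - volume A := by
    refine ENNReal.le_sub_of_add_le_left
      (ne_top_of_le_ne_top (by simp [Real.volume_Ioo]) (measure_union_le _ _)) ?_
    refine (add_le_add_left (measure_union_le _ _) _).trans ?_
    rw [Real.volume_Ioo, Real.volume_Ioo, ← ENNReal.ofReal_add (by linarith) (by linarith),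
      ← ENNReal.ofReal_add (by linarith) (by linarith), hx, ← ENNReal.ofReal_coe_nnreal]
    apply ENNReal.ofReal_le_ofReal
    linarith
  rw [hx]
  calc (x : ℝ≥0∞) ^ (m + 1) = ENNReal.ofReal ((x : ℝ) ^ (m + 1)) := by
        rw [ENNReal.ofReal_pow hx0, ENNReal.ofReal_coe_nnreal]
    _ ≤ ENNReal.ofReal ((2 * Real.pi) ^ (m + 1) * ((x / (2 * Real.pi) : ℝ) ^ m * (x / 2))) := by
        apply ENNReal.ofReal_le_ofReal
        have : (2 * Real.pi) ^ (m + 1) * ((x / (2 * Real.pi) : ℝ) ^ m * (x / 2))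
            = Real.pi * (x : ℝ) ^ (m + 1) := by
          rw [div_pow]; field_simp; ring
        rw [this]
        have := Real.pi_gt_three
        nlinarith [pow_nonneg hx0 (m + 1)]
    _ = ENNReal.ofReal (2 * Real.pi) ^ (m + 1) *
          (ENNReal.ofReal ((x / (2 * Real.pi) : ℝ) ^ m) * ENNReal.ofReal (x / 2)) := by
        rw [ENNReal.ofReal_mul (by positivity), ENNReal.ofReal_mul (by positivity),
          ENNReal.ofReal_pow (p := 2 * Real.pi) (by positivity)]
    _ ≤ _ := by
        gcongr
        exact (mul_le_mul_right h2 _).trans h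

/-! ### Distribution of the distance to the origin along a geodesic -/

/-- Radial distribution of arc length along a line at distance `ρ` from the origin. -/
theorem volume_preimage_sqrt_le {n : ℕ} (hn : 2 ≤ n) (ρ : ℝ) {E : Set ℝ} (hE : MeasurableSet E) :
    volume ((fun t => √(ρ ^ 2 + t ^ 2)) ⁻¹' E) ≤ 4 * radialPow (n - 1) E ^ (1 / (n : ℝ)) := by
  obtain ⟨m, rfl⟩ : ∃ m, n = m + 2 := ⟨n - 2, by omega⟩
  set τ : ℝ → ℝ := fun t => √(ρ ^ 2 + t ^ 2) with hτ
  have hτm : Measurable τ := by fun_prop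
  set T := τ ⁻¹' E ∩ Set.Ioi 0
  have hT : MeasurableSet T := (hτm hE).inter measurableSet_Ioi
  have hpos : ∀ t ∈ T, 0 < τ t := fun t ht => Real.sqrt_pos.2 (by
    have : 0 < t := ht.2
    positivity)
  have hle : ∀ t ∈ T, t ≤ τ t := fun t ht => Real.le_sqrt_of_sq_le (by nlinarith [sq_nonneg ρ])
  have hder : ∀ t ∈ T, HasDerivWithinAt τ (t / τ t) T t := fun t ht => by
    have h1 : HasDerivAt (fun t : ℝ => ρ ^ 2 + t ^ 2) (2 * t) t := by
      simpa using (hasDerivAt_pow 2 t).const_add (ρ ^ 2)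
    have h2 := h1.sqrt (Real.sqrt_pos.1 (hpos t ht)).ne'
    rw [mul_div_mul_left _ _ two_ne_zero] at h2
    exact h2.hasDerivWithinAt
  have hinj : Set.InjOn τ T := fun s hs t ht h => by
    have h1 := (Real.sqrt_inj (by positivity) (by positivity)).1 h
    exact (pow_left_inj₀ (le_of_lt hs.2) (le_of_lt ht.2) two_ne_zero).1 (by linarith)
  -- Change of variables r = τ(t): since dr = (t/r) dt, the weight r^(m+1) dr becomes t r^m dt, and
  -- r ≥ t.
  have hκ : ∫⁻ t in T, ENNReal.ofReal (t ^ (m + 1)) ≤ radialPow (m + 1) E := by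
    calc ∫⁻ t in T, ENNReal.ofReal (t ^ (m + 1))
        ≤ ∫⁻ t in T, ENNReal.ofReal |t / τ t| * ENNReal.ofReal (τ t ^ (m + 1)) := by
          refine setLIntegral_mono' hT fun t ht => ?_
          have h0 : 0 < t := ht.2
          have h1 := hpos t ht
          rw [abs_of_pos (by positivity), ← ENNReal.ofReal_mul (by positivity)]
          apply ENNReal.ofReal_le_ofReal
          have h2 : t / τ t * τ t ^ (m + 1) = t * τ t ^ m := by field_simp; ring
          rw [h2, pow_succ']
          gcongr
          exact hle t ht
      _ = ∫⁻ r in τ '' T, ENNReal.ofReal (r ^ (m + 1)) :=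
          (lintegral_image_eq_lintegral_abs_deriv_mul hT hder hinj
            (fun r => ENNReal.ofReal (r ^ (m + 1)))).symm
      _ ≤ ∫⁻ r in E ∩ Set.Ioi 0, ENNReal.ofReal (r ^ (m + 1)) :=
          lintegral_mono_set (Set.image_subset_iff.2 fun t ht => ⟨ht.1, hpos t ht⟩)
      _ = radialPow (m + 1) E := by
          rw [radialPow, withDensity_apply _ hE, Measure.restrict_restrict hE]
  refine ENNReal.le_mul_rpow_of_pow_le (by omega) ?_
  -- The constant 4 is one factor 2 from the reflection t ↦ -t and one from the weighted estimate.
  calc volume (τ ⁻¹' E) ^ (m + 2) ≤ (2 * volume T) ^ (m + 2) := by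
        gcongr
        refine volume_le_two_mul_of_neg_mem fun t ht => ?_
        simpa [hτ] using ht
    _ ≤ 2 ^ (m + 2) * (2 ^ (m + 2) * radialPow (m + 1) E) := by
        rw [mul_pow]
        gcongr
        refine (volume_pow_le_setLIntegral_pow hT Set.inter_subset_right (m + 1)).trans ?_
        gcongr
    _ = 4 ^ (m + 2) * radialPow (m + 2 - 1) E := by
        rw [← mul_assoc, ← mul_pow]
        norm_num

/-- Radial distribution of arc length along a great circle whose largest height over the
equatorial hyperplane is `k`. -/
theorem volume_preimage_arccos_le {n : ℕ} (hn : 2 ≤ n) {k : ℝ} (hk : 0 < k) (hk1 : k ≤ 1)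
    {E : Set ℝ} (hE : MeasurableSet E) :
    volume ((fun t => Real.arccos (k * Real.cos t)) ⁻¹' E ∩ Set.Ioo (-Real.pi) Real.pi) ≤
      ENNReal.ofReal (4 * Real.pi / k) * sinPow (n - 1) E ^ (1 / (n : ℝ)) := by
  obtain ⟨m, rfl⟩ : ∃ m, n = m + 2 := ⟨n - 2, by omega⟩
  have hpi := Real.pi_pos
  set τ : ℝ → ℝ := fun t => Real.arccos (k * Real.cos t) with hτ
  have hτm : Measurable τ := Real.measurable_arccos.comp (by fun_prop)
  set T := τ ⁻¹' E ∩ Set.Ioo (-Real.pi) Real.pi ∩ Set.Ioi 0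
  have hT : MeasurableSet T := ((hτm hE).inter measurableSet_Ioo).inter measurableSet_Ioi
  have hT0 : T ⊆ Set.Ioo 0 Real.pi := fun t ht => ⟨ht.2, ht.1.2.2⟩
  have hsin : ∀ t ∈ T, 0 < Real.sin t := fun t ht =>
    Real.sin_pos_of_pos_of_lt_pi (hT0 ht).1 (hT0 ht).2
  have habs : ∀ t ∈ T, (k * Real.cos t) ^ 2 ≤ Real.cos t ^ 2 := fun t ht => by
    rw [mul_pow]
    exact mul_le_of_le_one_left (sq_nonneg _) (pow_le_one₀ hk.le hk1)
  have hlt : ∀ t ∈ T, (k * Real.cos t) ^ 2 < 1 := fun t ht => by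
    have := hsin t ht
    nlinarith [habs t ht, Real.sin_sq_add_cos_sq t]
  have hbd : ∀ t ∈ T, -1 < k * Real.cos t ∧ k * Real.cos t < 1 := fun t ht =>
    abs_lt.1 ((sq_lt_one_iff_abs_lt_one _).1 (hlt t ht))
  have hsinτ : ∀ t, Real.sin (τ t) = √(1 - (k * Real.cos t) ^ 2) := fun t => Real.sin_arccos _
  have hle : ∀ t ∈ T, Real.sin t ≤ Real.sin (τ t) := fun t ht => by
    rw [hsinτ]
    exact Real.le_sqrt_of_sq_le (by nlinarith [habs t ht, Real.sin_sq_add_cos_sq t])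
  have hmem : ∀ t ∈ T, τ t ∈ Set.Ioo 0 Real.pi := fun t ht =>
    ⟨Real.arccos_pos.2 (hbd t ht).2, Real.arccos_lt_pi.2 (hbd t ht).1⟩
  have hder : ∀ t ∈ T, HasDerivWithinAt τ (k * Real.sin t / Real.sin (τ t)) T t := fun t ht => by
    have h1 := (Real.hasDerivAt_arccos (hbd t ht).1.ne' (hbd t ht).2.ne).comp t
      ((Real.hasDerivAt_cos t).const_mul k)
    refine (h1.congr_deriv ?_).hasDerivWithinAt
    rw [hsinτ]
    ring
  have hinj : Set.InjOn τ T := fun s hs t ht h => by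
    have h1 := Real.arccos_injOn ⟨(hbd s hs).1.le, (hbd s hs).2.le⟩
      ⟨(hbd t ht).1.le, (hbd t ht).2.le⟩ h
    exact Real.injOn_cos (Set.Ioo_subset_Icc_self (hT0 hs)) (Set.Ioo_subset_Icc_self (hT0 ht))
      (mul_left_cancel₀ hk.ne' h1)
  -- Here dr = k (sin t / sin r) dt, so sin^(m+1) r dr = k sin t sin^m r dt, and sin r ≥ sin t
  -- because k ≤ 1.
  have hκ : ENNReal.ofReal k * ∫⁻ t in T, ENNReal.ofReal (Real.sin t ^ (m + 1)) ≤
      sinPow (m + 1) E := by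
    calc ENNReal.ofReal k * ∫⁻ t in T, ENNReal.ofReal (Real.sin t ^ (m + 1))
        = ∫⁻ t in T, ENNReal.ofReal k * ENNReal.ofReal (Real.sin t ^ (m + 1)) :=
          (lintegral_const_mul' _ _ ENNReal.ofReal_ne_top).symm
      _ ≤ ∫⁻ t in T, ENNReal.ofReal |k * Real.sin t / Real.sin (τ t)| *
            ENNReal.ofReal (Real.sin (τ t) ^ (m + 1)) := by
          refine setLIntegral_mono' hT fun t ht => ?_
          have h0 := hsin t ht
          have h1 : 0 < Real.sin (τ t) := h0.trans_le (hle t ht)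
          rw [abs_of_pos (by positivity), ← ENNReal.ofReal_mul (by positivity),
            ← ENNReal.ofReal_mul (by positivity)]
          apply ENNReal.ofReal_le_ofReal
          have h2 : k * Real.sin t / Real.sin (τ t) * Real.sin (τ t) ^ (m + 1)
              = k * (Real.sin t * Real.sin (τ t) ^ m) := by field_simp; ring
          rw [h2, pow_succ']
          gcongr
          exact hle t ht
      _ = ∫⁻ r in τ '' T, ENNReal.ofReal (Real.sin r ^ (m + 1)) :=
          (lintegral_image_eq_lintegral_abs_deriv_mul hT hder hinj
            (fun r => ENNReal.ofReal (Real.sin r ^ (m + 1)))).symm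
      _ ≤ ∫⁻ r in E ∩ Set.Ioo 0 Real.pi, ENNReal.ofReal (Real.sin r ^ (m + 1)) :=
          lintegral_mono_set (Set.image_subset_iff.2 fun t ht => ⟨ht.1.1, hmem t ht⟩)
      _ = sinPow (m + 1) E := by
          rw [sinPow, withDensity_apply _ hE, Measure.restrict_restrict hE]
  refine ENNReal.le_mul_rpow_of_pow_le (by omega) ?_
  calc volume (τ ⁻¹' E ∩ Set.Ioo (-Real.pi) Real.pi) ^ (m + 2) ≤ (2 * volume T) ^ (m + 2) := by
        gcongr
        refine volume_le_two_mul_of_neg_mem fun t ht => ⟨?_, ?_⟩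
        · simpa [hτ] using ht.1
        · exact ⟨neg_lt_neg ht.2.2, by linarith [ht.2.1]⟩
    _ ≤ 2 ^ (m + 2) * (ENNReal.ofReal (2 * Real.pi) ^ (m + 2) *
          (ENNReal.ofReal k⁻¹ ^ (m + 2) * sinPow (m + 1) E)) := by
        rw [mul_pow]
        gcongr
        refine (volume_pow_le_setLIntegral_sin_pow hT hT0 (m + 1)).trans ?_
        gcongr
        -- The factor k⁻¹ is enlarged to k^(-(m+2)), so that the root of order n = m + 2 gives 1/k.
        -- This is cruder than k^(-1/n), but the weight k in the theorem absorbs it.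
        have h1 : 1 ≤ k⁻¹ := one_le_inv_iff₀.2 ⟨hk, hk1⟩
        calc ∫⁻ t in T, ENNReal.ofReal (Real.sin t ^ (m + 1))
            = ENNReal.ofReal k⁻¹ *
                (ENNReal.ofReal k * ∫⁻ t in T, ENNReal.ofReal (Real.sin t ^ (m + 1))) := by
              rw [← mul_assoc, ← ENNReal.ofReal_mul (by positivity), inv_mul_cancel₀ hk.ne']
              simp
          _ ≤ ENNReal.ofReal k⁻¹ ^ (m + 2) * sinPow (m + 1) E := by
              gcongr
              exact le_self_pow₀ (by simpa using h1) (by omega)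
    _ = ENNReal.ofReal (4 * Real.pi / k) ^ (m + 2) * sinPow (m + 2 - 1) E := by
        rw [← mul_assoc, ← mul_assoc, ← mul_pow, ← mul_pow, ← ENNReal.ofReal_ofNat,
          ← ENNReal.ofReal_mul (by positivity), ← ENNReal.ofReal_mul (by positivity)]
        congr 3
        ring

/-! ### From radial sets to radial functions, and arc length -/

/-- Lorentz space bound for the integral of a radial function with respect to a measure `ν` whose
radial distribution is controlled by the radial part `κ` of `μ`. -/
theorem lintegral_radial_le_lorentzNorm {X S : Type*} [MeasurableSpace X] [MeasurableSpace S]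
    {σ : Measure S} [IsFiniteMeasure σ] (hσ : σ ≠ 0) {κ : Measure ℝ} [SFinite κ] {μ ν : Measure X}
    {Φ : S × ℝ → X} (hΦ : MeasurePreserving Φ (σ.prod κ) μ) {rad : X → ℝ} (hrad : Measurable rad)
    (hΦrad : ∀ᵐ q ∂σ.prod κ, rad (Φ q) = q.2) {F : ℝ → ℂ} {p : ℝ} (hp : 0 < p) {C : ℝ≥0∞}
    (hC : C ≠ ⊤) (hν : ∀ E, MeasurableSet E → ν (rad ⁻¹' E) ≤ C * κ E ^ (1 / p))
    (hF : AEStronglyMeasurable (fun x => F (rad x)) μ) :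
    AEStronglyMeasurable (fun x => F (rad x)) ν ∧
      ∫⁻ x, ‖F (rad x)‖ₑ ∂ν ≤
        C * σ Set.univ ^ (-(1 / p)) * lorentzNorm (fun x => F (rad x)) p 1 μ := by
  have hσ0 : σ Set.univ ≠ 0 := by simpa using hσ
  have hσt : σ Set.univ ≠ ⊤ := measure_ne_top σ _
  have hFκ : AEStronglyMeasurable F κ := by
    refine AEStronglyMeasurable.of_comp_snd (μ := σ) ?_ hσ
    refine (hF.comp_measurePreserving hΦ).congr ?_
    filter_upwards [hΦrad] with q hq
    simp [hq]
  -- In the coordinates Φ a superlevel set is S times a subset of ℝ, so F ∘ rad under μ and F under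
  -- σ(S)·κ are equidistributed. Rescaling κ produces the factor σ(S)^(-1/p).
  have hL : lorentzNorm (fun x => F (rad x)) p 1 μ = lorentzNorm F p 1 (σ Set.univ • κ) := by
    refine lorentzNorm_congr_distribution p 1 fun s => ?_
    have hs : NullMeasurableSet {x | (s : ℝ≥0∞) < ‖F (rad x)‖ₑ} μ :=
      nullMeasurableSet_lt aemeasurable_const hF.enorm
    rw [← hΦ.measure_preimage hs, Measure.smul_apply, smul_eq_mul, ← Measure.prod_prod]
    refine measure_congr ?_
    filter_upwards [hΦrad] with q hq
    simp only [eq_iff_iff]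
    change (s : ℝ≥0∞) < ‖F (rad (Φ q))‖ₑ ↔ q.1 ∈ Set.univ ∧ (s : ℝ≥0∞) < ‖F q.2‖ₑ
    rw [hq]
    simp
  have hC' : C * σ Set.univ ^ (-(1 / p)) ≠ ⊤ :=
    ENNReal.mul_ne_top hC (ENNReal.rpow_ne_top_of_ne_zero hσ0 hσt)
  obtain ⟨h1, h2⟩ := lintegral_enorm_le_lorentzNorm hp (F := F) (μ := σ Set.univ • κ)
    (ν := Measure.map rad ν) hC' (fun E hE => by
      rw [Measure.map_apply hrad hE, Measure.smul_apply, smul_eq_mul,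
        ENNReal.mul_rpow_of_nonneg _ _ (one_div_pos.2 hp).le, mul_assoc, ← mul_assoc (_ ^ _),
        ENNReal.rpow_neg, ENNReal.inv_mul_cancel, one_mul]
      · exact hν E hE
      · exact (ENNReal.rpow_pos (pos_iff_ne_zero.2 hσ0) hσt).ne'
      · exact ENNReal.rpow_ne_top_of_nonneg (one_div_pos.2 hp).le hσt) (hFκ.smul_measure _)
  refine ⟨h1.comp_measurable hrad, ?_⟩
  rw [hL]
  rwa [lintegral_map' h1.enorm hrad.aemeasurable] at h2

/-- A 1-Lipschitz map does not increase one-dimensional Hausdorff measure, which on ℝ is Lebesgue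
measure. Only this upper bound for arc length is needed; S is a parameter set covering the curve,
such as one period. -/
theorem hausdorffMeasure_inter_range_le {X : Type*} [MetricSpace X] [MeasurableSpace X]
    [BorelSpace X] {γ : ℝ → X} (hγ : LipschitzWith 1 γ) {S : Set ℝ}
    (hS : Set.range γ ⊆ γ '' S) (A : Set X) :
    (Measure.hausdorffMeasure 1 : Measure X) (A ∩ Set.range γ) ≤ volume (γ ⁻¹' A ∩ S) :=
  calc (Measure.hausdorffMeasure 1 : Measure X) (A ∩ Set.range γ)
      ≤ (Measure.hausdorffMeasure 1 : Measure X) (γ '' (γ ⁻¹' A ∩ S)) := by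
        refine measure_mono ?_
        rintro x ⟨hx, hx'⟩
        obtain ⟨t, ht, rfl⟩ := hS hx'
        exact ⟨t, ⟨hx, ht⟩, rfl⟩
    _ ≤ volume (γ ⁻¹' A ∩ S) := by
        simpa [hausdorffMeasure_real] using hγ.hausdorffMeasure_image_le zero_le_one (γ ⁻¹' A ∩ S)

/-! ### Explicit form of the geodesics -/

section Geodesics

variable {E : Type*} [NormedAddCommGroup E] [InnerProductSpace ℝ E]

theorem IsUnitSpeedGeodesic.lipschitzWith {X : Type*} [MetricSpace X] {ι : X → E}
    (hι : Isometry ι) {γ : ℝ → X} (h : IsUnitSpeedGeodesic ι γ) : LipschitzWith 1 γ :=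
  (hι.lipschitzWith_iff 1).1
    (lipschitzWith_of_nnnorm_deriv_le (h.1.differentiable (by simp)) fun t => by
      rw [← NNReal.coe_le_coe]
      simpa using (h.2.1 t).le)

theorem IsUnitSpeedGeodesic.hasDerivAt {X : Type*} {ι : X → E} {γ : ℝ → X}
    (h : IsUnitSpeedGeodesic ι γ) (t : ℝ) :
    HasDerivAt (ι ∘ γ) (deriv (ι ∘ γ) t) t ∧
      HasDerivAt (deriv (ι ∘ γ)) (deriv (deriv (ι ∘ γ)) t) t := by
  have h1 : ContDiff ℝ ∞ (deriv (ι ∘ γ)) := (contDiff_infty_iff_deriv.1 h.1).2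
  exact ⟨(h.1.differentiable (by simp) t).hasDerivAt, (h1.differentiable (by simp) t).hasDerivAt⟩

/-- In a vector space every direction is tangent, so testing against a line in the direction of the
acceleration makes it vanish. The parameter is shifted to the foot of the perpendicular from 0, and
Pythagoras applies. -/
theorem IsUnitSpeedGeodesic.exists_dist_eq_sqrt {γ : ℝ → E} (h : IsUnitSpeedGeodesic id γ) :
    ∃ t₀ ρ : ℝ, ∀ t, dist 0 (γ (t + t₀)) = √(ρ ^ 2 + t ^ 2) := by
  have hd := fun t => (h.hasDerivAt t).1
  have hd2 := fun t => (h.hasDerivAt t).2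
  have h1 := h.2.1
  have h3 := h.2.2
  rw [Function.id_comp] at *
  have h2 : ∀ t, deriv (deriv γ) t = 0 := fun t => by
    set w := deriv (deriv γ) t with hw
    have h4 : ∀ s : ℝ, HasDerivAt (fun s : ℝ => γ t + s • w) w s := fun s => by
      simpa using ((hasDerivAt_id s).smul_const w).const_add (γ t)
    have h5 := h3 t (fun s => γ t + s • w) (by
      rw [Function.id_comp]
      fun_prop) (by simp)
    rw [Function.id_comp, (h4 0).deriv] at h5
    exact inner_self_eq_zero.1 h5
  set v := deriv γ 0 with hv
  have hv' : ∀ t, deriv γ t = v := fun t =>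
    is_const_of_deriv_eq_zero (fun t => (hd2 t).differentiableAt) h2 t 0
  have hv1 : ‖v‖ = 1 := h1 0
  have hline : ∀ t, γ t = γ 0 + t • v := fun t => by
    have h6 : ∀ s, HasDerivAt (fun s : ℝ => γ s - s • v) 0 s := fun s => by
      exact ((hd s).sub ((hasDerivAt_id s).smul_const v)).congr_deriv (by simp [hv' s])
    have h7 := is_const_of_deriv_eq_zero (fun s => (h6 s).differentiableAt)
      (fun s => (h6 s).deriv) t 0
    simp only [zero_smul, sub_zero] at h7
    rw [← h7]
    abel
  set c := inner ℝ (γ 0) v with hc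
  refine ⟨-c, ‖γ 0 - c • v‖, fun t => ?_⟩
  have h8 : γ (t + -c) = (γ 0 - c • v) + t • v := by
    rw [hline]
    module
  have h9 : inner ℝ (γ 0 - c • v) (t • v) = 0 := by
    rw [inner_smul_right, inner_sub_left, inner_smul_left, real_inner_self_eq_norm_sq, hv1]
    simp [hc]
  rw [dist_zero_left, h8]
  have h10 := norm_add_sq_eq_norm_sq_add_norm_sq_of_inner_eq_zero _ _ h9
  rw [norm_smul, hv1, mul_one, Real.norm_eq_abs, abs_mul_abs_self] at h10
  rw [← Real.sqrt_mul_self (norm_nonneg (γ 0 - c • v + t • v)), h10]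
  ring_nf

/-- The geodesics of the unit sphere are the great circles. -/
theorem IsUnitSpeedGeodesic.eq_cos_smul_add_sin_smul {γ : ℝ → Metric.sphere (0 : E) 1}
    (h : IsUnitSpeedGeodesic Subtype.val γ) :
    ∃ a v : E, ∀ t, (γ t : E) = Real.cos t • a + Real.sin t • v := by
  set c : ℝ → E := Subtype.val ∘ γ with hc
  have hd := fun t => (h.hasDerivAt t).1
  have hd2 := fun t => (h.hasDerivAt t).2
  have h1 := h.2.1
  have h3 := h.2.2
  rw [← hc] at hd hd2 h1 h3
  have hcn : ∀ t, ‖c t‖ = 1 := fun t => norm_eq_of_mem_sphere (γ t)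
  have hin : ∀ t, inner ℝ (c t) (deriv c t) = 0 := fun t => by
    have h4 := (hd t).inner ℝ (hd t)
    have h5 : (fun t => inner ℝ (c t) (c t)) = fun _ => (1 : ℝ) := by
      funext t
      rw [real_inner_self_eq_norm_sq, hcn, one_pow]
    rw [h5] at h4
    have h6 := h4.unique (hasDerivAt_const t (1 : ℝ))
    rw [real_inner_comm (c t)] at h6
    linarith [real_inner_comm (c t) (deriv c t)]
  have hin2 : ∀ t, inner ℝ (c t) (deriv (deriv c) t) = -1 := fun t => by
    have h4 := (hd t).inner ℝ (hd2 t)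
    rw [funext hin] at h4
    have h6 := h4.unique (hasDerivAt_const t (0 : ℝ))
    rw [real_inner_self_eq_norm_sq, h1] at h6
    linarith
  -- The test curve is the great circle through c t with initial velocity w.
  have hperp : ∀ t (w : E), ‖w‖ = 1 → inner ℝ (c t) w = 0 →
      inner ℝ (deriv (deriv c) t) w = 0 := fun t w hw hcw => by
    let σ : ℝ → Metric.sphere (0 : E) 1 := fun s => ⟨Real.cos s • c t + Real.sin s • w, by
      have h4 : inner ℝ (Real.cos s • c t) (Real.sin s • w) = 0 := by
        rw [inner_smul_left, inner_smul_right, hcw]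
        simp
      have h5 := norm_add_sq_eq_norm_sq_add_norm_sq_of_inner_eq_zero _ _ h4
      rw [norm_smul, norm_smul, hcn, hw, mul_one, mul_one, Real.norm_eq_abs, Real.norm_eq_abs,
        abs_mul_abs_self, abs_mul_abs_self] at h5
      rw [mem_sphere_zero_iff_norm]
      nlinarith [Real.sin_sq_add_cos_sq s,
        norm_nonneg (Real.cos s • c t + Real.sin s • w)]⟩
    have hσ : Subtype.val ∘ σ = fun s => Real.cos s • c t + Real.sin s • w := rfl
    have h4 := h3 t σ (by
      rw [hσ]
      exact (Real.contDiff_cos.smul contDiff_const).add (Real.contDiff_sin.smul contDiff_const))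
      (Subtype.ext (by simp [σ, hc]))
    have h5 : HasDerivAt (Subtype.val ∘ σ) w 0 := by
      exact (((Real.hasDerivAt_cos 0).smul_const (c t)).add
        ((Real.hasDerivAt_sin 0).smul_const w)).congr_deriv (by simp)
    rwa [h5.deriv] at h4
  -- The vector u = c'' + c is orthogonal to c, hence tangent, hence orthogonal to c'' too; so ⟨u,
  -- u⟩ = 0.
  have hode : ∀ t, deriv (deriv c) t = -c t := fun t => by
    set u := deriv (deriv c) t + c t with hu
    have hcu : inner ℝ (c t) u = 0 := by
      rw [hu, inner_add_right, hin2, real_inner_self_eq_norm_sq, hcn]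
      norm_num
    have h0 : u = 0 := by
      by_contra hne
      have hun : ‖u‖ ≠ 0 := norm_ne_zero_iff.2 hne
      have h4 := hperp t (‖u‖⁻¹ • u) (by
        rw [norm_smul, norm_inv, norm_norm, inv_mul_cancel₀ hun])
        (by rw [inner_smul_right, hcu, mul_zero])
      rw [inner_smul_right, mul_eq_zero, inv_eq_zero, or_iff_right hun] at h4
      have h5 : inner ℝ u u = 0 := by
        nth_rewrite 1 [hu]
        rw [inner_add_left, h4, hcu, add_zero]
      exact hne (inner_self_eq_zero.1 h5)
    exact eq_neg_of_add_eq_zero_left h0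
  -- Rotating the pair (c, c') back by the angle t gives two constants of motion, which solve the
  -- equation explicitly.
  have hA : ∀ t, HasDerivAt (fun t => Real.cos t • c t - Real.sin t • deriv c t) 0 t := fun t => by
    have := ((Real.hasDerivAt_cos t).smul (hd t)).sub ((Real.hasDerivAt_sin t).smul (hd2 t))
    refine this.congr_deriv ?_
    rw [hode]
    module
  have hB : ∀ t, HasDerivAt (fun t => Real.sin t • c t + Real.cos t • deriv c t) 0 t := fun t => by
    have := ((Real.hasDerivAt_sin t).smul (hd t)).add ((Real.hasDerivAt_cos t).smul (hd2 t))
    refine this.congr_deriv ?_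
    rw [hode]
    module
  refine ⟨c 0, deriv c 0, fun t => ?_⟩
  have hA' := is_const_of_deriv_eq_zero (fun s => (hA s).differentiableAt)
    (fun s => (hA s).deriv) t 0
  have hB' := is_const_of_deriv_eq_zero (fun s => (hB s).differentiableAt)
    (fun s => (hB s).deriv) t 0
  simp only [Real.cos_zero, Real.sin_zero, one_smul, zero_smul, sub_zero, zero_add] at hA' hB'
  rw [← hA', ← hB']
  change c t = _
  have h4 : c t = (Real.sin t ^ 2 + Real.cos t ^ 2) • c t := by
    rw [Real.sin_sq_add_cos_sq, one_smul]
  nth_rewrite 1 [h4]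
  module

end Geodesics

/-- The height a cos t + v sin t is |z| cos(t - arg z) for z = a + iv. Its amplitude is attained as
a coordinate of a unit vector, hence is at most 1. -/
theorem IsUnitSpeedGeodesic.exists_last_eq_mul_cos {n : ℕ} {γ : ℝ → UnitSphere n}
    (h : IsUnitSpeedGeodesic Subtype.val γ) :
    ∃ t₀ k : ℝ, 0 ≤ k ∧ k ≤ 1 ∧
      ∀ t, (γ (t + t₀) : EuclideanSpace ℝ (Fin (n + 1))) (Fin.last n) = k * Real.cos t := by
  obtain ⟨a, v, hav⟩ := h.eq_cos_smul_add_sin_smul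
  set z : ℂ := ⟨a (Fin.last n), v (Fin.last n)⟩
  have hz1 : a (Fin.last n) = ‖z‖ * Real.cos z.arg := (Complex.norm_mul_cos_arg z).symm
  have hz2 : v (Fin.last n) = ‖z‖ * Real.sin z.arg := (Complex.norm_mul_sin_arg z).symm
  have key : ∀ t, (γ (t + z.arg) : EuclideanSpace ℝ (Fin (n + 1))) (Fin.last n)
      = ‖z‖ * Real.cos t := fun t => by
    rw [hav, PiLp.add_apply, PiLp.smul_apply, PiLp.smul_apply, hz1, hz2, smul_eq_mul, smul_eq_mul]
    have : Real.cos t = Real.cos ((t + z.arg) - z.arg) := by ring_nf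
    rw [this, Real.cos_sub]
    ring
  refine ⟨z.arg, ‖z‖, norm_nonneg _, ?_, key⟩
  have h1 := key 0
  rw [Real.cos_zero, mul_one] at h1
  rw [← h1]
  calc _ ≤ ‖(γ (0 + z.arg) : EuclideanSpace ℝ (Fin (n + 1))) (Fin.last n)‖ := Real.le_norm_self _
    _ ≤ ‖(γ (0 + z.arg) : EuclideanSpace ℝ (Fin (n + 1)))‖ := PiLp.norm_apply_le _ _
    _ = 1 := norm_eq_of_mem_sphere _

theorem IsUnitSpeedGeodesic.periodic {n : ℕ} {γ : ℝ → UnitSphere n}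
    (h : IsUnitSpeedGeodesic Subtype.val γ) : Function.Periodic γ (2 * Real.pi) := by
  obtain ⟨a, v, hav⟩ := h.eq_cos_smul_add_sin_smul
  intro t
  ext1
  rw [hav, hav, Real.cos_add_two_pi, Real.sin_add_two_pi]

/-! ### Bounds on a single geodesic and conclusion -/

theorem exists_radial_profile {X : Type*} {c : ℝ} {d : X → X → ℝ} {o : X} {f : X → ℂ}
    (h : IsRadialAbout c d o f) : ∃ F : ℝ → ℂ, f = fun x => F (d o x) := by
  obtain ⟨g, hg⟩ := h
  exact ⟨fun t => g (curvatureFn c (t / 2)), funext hg⟩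

theorem deriv_curvatureFn_zero (t : ℝ) : deriv (curvatureFn 0) t = 1 := by
  have : curvatureFn 0 = id := by
    funext t
    simp [curvatureFn]
  rw [this, deriv_id]

theorem deriv_curvatureFn_one (t : ℝ) : deriv (curvatureFn 1) t = Real.cos t := by
  have : curvatureFn 1 = Real.sin := by
    funext t
    simp [curvatureFn]
  rw [this, Real.deriv_sin]

theorem measurable_sphericalDist_northPole (n : ℕ) :
    Measurable (sphericalDist (northPole n)) := by
  have : sphericalDist (northPole n) = fun x : UnitSphere n =>
      Real.arccos ((x : EuclideanSpace ℝ (Fin (n + 1))) (Fin.last n)) :=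
    funext sphericalDist_northPole
  rw [this]
  have : Continuous fun x : UnitSphere n =>
      Real.arccos ((x : EuclideanSpace ℝ (Fin (n + 1))) (Fin.last n)) :=
    Real.continuous_arccos.comp (by fun_prop)
  exact this.measurable

theorem enorm_smul_xrayTransform_le {X : Type*} [MetricSpace X] [MeasurableSpace X] [BorelSpace X]
    (a : ℝ) (f : X → ℂ) (ξ : Set X) : ‖a • xrayTransform f ξ‖ₑ ≤
      ‖a‖ₑ * ∫⁻ x in ξ, ‖f x‖ₑ ∂(Measure.hausdorffMeasure 1 : Measure X) := by
  rw [enorm_smul]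
  gcongr
  exact enorm_integral_le_lintegral_enorm f

theorem range_comp_add_right {X : Type*} (γ : ℝ → X) (t₀ : ℝ) :
    Set.range (fun t => γ (t + t₀)) = Set.range γ :=
  (Equiv.addRight t₀).surjective.range_comp γ

/-- The total measure of the unit sphere of `ℝ^n`. -/
noncomputable def sphereArea (n : ℕ) : ℝ≥0∞ :=
  (volume : Measure (EuclideanSpace ℝ (Fin n))).toSphere Set.univ

theorem euclidean_line_bound {n : ℕ} (hn : 2 ≤ n) {f : EuclideanSpace ℝ (Fin n) → ℂ}
    (hf : IsRadialAbout 0 dist 0 f) (hm : AEStronglyMeasurable f volume)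
    {ξ : Set (EuclideanSpace ℝ (Fin n))}
    (hξ : ξ ∈ geodesicLines (id : EuclideanSpace ℝ (Fin n) → EuclideanSpace ℝ (Fin n))) :
    AEStronglyMeasurable f ((Measure.hausdorffMeasure 1).restrict ξ) ∧
      ∫⁻ x in ξ, ‖f x‖ₑ ∂(Measure.hausdorffMeasure 1) ≤
        4 * sphereArea n ^ (-(1 / (n : ℝ))) * lorentzNorm f n 1 volume := by
  obtain ⟨F, rfl⟩ := exists_radial_profile hf
  obtain ⟨γ, hγ, rfl⟩ := hξ
  obtain ⟨t₀, ρ, hρ⟩ := hγ.exists_dist_eq_sqrt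
  have : Nonempty (Fin n) := ⟨⟨0, by omega⟩⟩
  have hpol := measurePreserving_polar (volume : Measure (EuclideanSpace ℝ (Fin n)))
  rw [finrank_euclideanSpace_fin] at hpol
  have hrad : Measurable fun x : EuclideanSpace ℝ (Fin n) => dist 0 x := by fun_prop
  refine lintegral_radial_le_lorentzNorm (rad := fun x => dist 0 x)
    (Measure.toSphere_ne_zero volume) hpol hrad ?_ (by positivity) (by simp) (fun E hE => ?_) hm
  · have h0 : ∀ᵐ r ∂radialPow (n - 1), 0 < r :=
      (withDensity_absolutelyContinuous _ _).ae_le (ae_restrict_mem measurableSet_Ioi)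
    filter_upwards [Measure.quasiMeasurePreserving_snd.ae h0] with q hq
    rw [dist_zero_left, norm_smul, norm_eq_of_mem_sphere, mul_one, Real.norm_eq_abs, abs_of_pos hq]
  · rw [Measure.restrict_apply (hrad hE), ← range_comp_add_right γ t₀]
    refine (hausdorffMeasure_inter_range_le (S := Set.univ) ?_ (by simp) _).trans ?_
    · exact (mul_one (1 : ℝ≥0)) ▸
        (hγ.lipschitzWith isometry_id).comp (isometry_add_right t₀).lipschitz
    · refine le_trans (le_of_eq ?_) (volume_preimage_sqrt_le hn ρ hE)
      rw [Set.inter_univ, ← Set.preimage_comp]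
      congr 2
      exact funext hρ

/-- The number k is the largest height on ξ, so d(o,ξ) = arccos k and the weight s_1'(d(o,ξ)) is k
itself. -/
theorem great_circle_bound {n : ℕ} (hn : 2 ≤ n) {f : UnitSphere n → ℂ}
    (hf : IsRadialAbout 1 sphericalDist (northPole n) f)
    (hm : AEStronglyMeasurable f (surfaceMeasure n)) {ξ : Set (UnitSphere n)}
    (hξ : ξ ∈ geodesicLines (Subtype.val : UnitSphere n → EuclideanSpace ℝ (Fin (n + 1)))) :
    ∃ k : ℝ, 0 ≤ k ∧ deriv (curvatureFn 1) (distToSet sphericalDist (northPole n) ξ) = k ∧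
      ((k = 0 ∧ IntegrableOn f ξ (Measure.hausdorffMeasure 1)) ∨
      (0 < k ∧ AEStronglyMeasurable f ((Measure.hausdorffMeasure 1).restrict ξ) ∧
        ∫⁻ x in ξ, ‖f x‖ₑ ∂(Measure.hausdorffMeasure 1) ≤
          ENNReal.ofReal (4 * Real.pi / k) * sphereArea n ^ (-(1 / (n : ℝ))) *
            lorentzNorm f n 1 (surfaceMeasure n))) := by
  obtain ⟨F, rfl⟩ := exists_radial_profile hf
  obtain ⟨γ, hγ, rfl⟩ := hξ
  obtain ⟨t₀, k, hk0, hk1, hk⟩ := hγ.exists_last_eq_mul_cos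
  have hdist : ∀ t, sphericalDist (northPole n) (γ (t + t₀)) = Real.arccos (k * Real.cos t) :=
    fun t => by rw [sphericalDist_northPole, hk]
  have hrad := measurable_sphericalDist_northPole n
  have hlip : LipschitzWith 1 fun t => γ (t + t₀) :=
    (mul_one (1 : ℝ≥0)) ▸
      (hγ.lipschitzWith isometry_subtype_coe).comp (isometry_add_right t₀).lipschitz
  have hrange : Set.range (fun t => γ (t + t₀)) ⊆
      (fun t => γ (t + t₀)) '' Set.Ioc (-Real.pi) Real.pi := by
    have hper : Function.Periodic (fun t => γ (t + t₀)) (2 * Real.pi) := fun t => by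
      change γ (t + 2 * Real.pi + t₀) = γ (t + t₀)
      rw [← hγ.periodic (t + t₀)]
      ring_nf
    have := hper.image_Ioc Real.two_pi_pos (-Real.pi)
    rw [show -Real.pi + 2 * Real.pi = Real.pi by ring] at this
    exact this.ge
  refine ⟨k, hk0, ?_, ?_⟩
  · have h1 : IsLeast (sphericalDist (northPole n) '' Set.range γ) (Real.arccos k) := by
      rw [← range_comp_add_right γ t₀, ← Set.range_comp]
      refine ⟨⟨0, (hdist 0).trans (by simp)⟩, ?_⟩
      rintro _ ⟨t, rfl⟩
      rw [Function.comp_apply, hdist]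
      exact Real.arccos_le_arccos (mul_le_of_le_one_right hk0 (Real.cos_le_one t))
    rw [deriv_curvatureFn_one, distToSet, h1.csInf_eq, Real.cos_arccos (by linarith) hk1]
  · rcases hk0.eq_or_lt with h0 | h0
    -- The equator is null for the surface measure, so the Lorentz norm gives no information on it;
    -- integrability follows because f is constant there and the length is finite.
    · refine Or.inl ⟨h0.symm, ?_⟩
      have hconst : ∀ x ∈ Set.range γ, sphericalDist (northPole n) x = Real.pi / 2 := by
        rw [← range_comp_add_right γ t₀]
        rintro _ ⟨t, rfl⟩
        rw [hdist, ← h0, zero_mul, Real.arccos_zero]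
      have hfin : (Measure.hausdorffMeasure 1 : Measure (UnitSphere n)) (Set.range γ) ≠ ⊤ := by
        have h2 := hausdorffMeasure_inter_range_le hlip hrange Set.univ
        rw [Set.univ_inter, range_comp_add_right] at h2
        exact ne_top_of_le_ne_top (by simp) h2
      refine (integrableOn_const (C := F (Real.pi / 2)) hfin).congr ?_
      have h3 : ∀ᵐ x ∂(Measure.hausdorffMeasure 1 : Measure (UnitSphere n)).restrict (Set.range γ),
          sphericalDist (northPole n) x = Real.pi / 2 :=
        (ae_restrict_iff (hrad (measurableSet_singleton _))).2 (.of_forall hconst)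
      filter_upwards [h3] with x hx
      rw [hx]
    · refine Or.inr ⟨h0, ?_⟩
      have hσ : (volume : Measure (EuclideanSpace ℝ (Fin n))).toSphere ≠ 0 := by
        have : Nonempty (Fin n) := ⟨⟨0, by omega⟩⟩
        exact Measure.toSphere_ne_zero volume
      refine lintegral_radial_le_lorentzNorm (rad := sphericalDist (northPole n)) hσ
        (measurePreserving_sphericalPoint (by omega)) hrad ?_ (by positivity) (by simp)
        (fun E hE => ?_) hm
      · have h1 : ∀ᵐ θ ∂sinPow (n - 1), θ ∈ Set.Ioo 0 Real.pi :=
          (withDensity_absolutelyContinuous _ _).ae_le (ae_restrict_mem measurableSet_Ioo)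
        filter_upwards [Measure.quasiMeasurePreserving_snd.ae h1] with q hq
        exact sphericalDist_northPole_sphericalPoint q (Set.Ioo_subset_Icc_self hq)
      · rw [Measure.restrict_apply (hrad hE), ← range_comp_add_right γ t₀]
        refine (hausdorffMeasure_inter_range_le hlip hrange _).trans ?_
        refine le_trans (le_of_eq ?_) (volume_preimage_arccos_le hn h0 hk1 hE)
        -- The half-open period covers the circle; the open one, equal to it up to a null set, is
        -- symmetric under t ↦ -t.
        rw [← Set.preimage_comp, measure_congr (Filter.EventuallyEq.rfl.inter Ioo_ae_eq_Ioc.symm)]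
        congr 3
        exact funext hdist

theorem mainTheorem3 (n : ℕ) (hn : 2 ≤ n) :
    ∃ K : ℝ≥0,
      -- the Euclidean space, `c = 0`
      (∀ f : EuclideanSpace ℝ (Fin n) → ℂ,
        IsRadialAbout 0 dist 0 f →
        MemLorentz f (n : ℝ) 1 volume →
        (∀ ξ ∈ geodesicLines (id : EuclideanSpace ℝ (Fin n) → EuclideanSpace ℝ (Fin n)),
          IntegrableOn f ξ (Measure.hausdorffMeasure 1)) ∧
        (⨆ ξ ∈ geodesicLines (id : EuclideanSpace ℝ (Fin n) → EuclideanSpace ℝ (Fin n)),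
          ‖deriv (curvatureFn 0) (distToSet dist 0 ξ) • xrayTransform f ξ‖ₑ)
            ≤ K * lorentzNorm f (n : ℝ) 1 volume) ∧
      -- the sphere, `c = 1`
      (∀ f : UnitSphere n → ℂ,
        IsRadialAbout 1 sphericalDist (northPole n) f →
        MemLorentz f (n : ℝ) 1 (surfaceMeasure n) →
        (∀ ξ ∈ geodesicLines (Subtype.val : UnitSphere n → EuclideanSpace ℝ (Fin (n + 1))),
          IntegrableOn f ξ (Measure.hausdorffMeasure 1)) ∧
        (⨆ ξ ∈ geodesicLines (Subtype.val : UnitSphere n → EuclideanSpace ℝ (Fin (n + 1))),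
          ‖deriv (curvatureFn 1) (distToSet sphericalDist (northPole n) ξ) •
            xrayTransform f ξ‖ₑ)
            ≤ K * lorentzNorm f (n : ℝ) 1 (surfaceMeasure n)) := by
  have hσ0 : sphereArea n ≠ 0 := by
    have : Nonempty (Fin n) := ⟨⟨0, by omega⟩⟩
    exact Measure.measure_univ_ne_zero.2 (Measure.toSphere_ne_zero volume)
  have hσt : sphereArea n ≠ ⊤ := measure_ne_top _ _
  have hc : sphereArea n ^ (-(1 / (n : ℝ))) ≠ ⊤ := ENNReal.rpow_ne_top_of_ne_zero hσ0 hσt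
  have hpi := Real.pi_gt_three
  -- The factor 4π is k · (4π/k) on the sphere and exceeds the Euclidean factor 4.
  refine ⟨(ENNReal.ofReal (4 * Real.pi) * sphereArea n ^ (-(1 / (n : ℝ)))).toNNReal, ?_, ?_⟩
  all_goals
    rw [ENNReal.coe_toNNReal (ENNReal.mul_ne_top ENNReal.ofReal_ne_top hc)]
    rintro f hf ⟨hm, hL⟩
  · refine ⟨fun ξ hξ => ?_, iSup₂_le fun ξ hξ => ?_⟩ <;>
      obtain ⟨h1, h2⟩ := euclidean_line_bound hn hf hm hξ
    · exact ⟨h1, h2.trans_lt (ENNReal.mul_lt_top (ENNReal.mul_lt_top (by simp) hc.lt_top) hL)⟩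
    · refine (enorm_smul_xrayTransform_le _ f ξ).trans ?_
      rw [deriv_curvatureFn_zero, enorm_one, one_mul]
      refine h2.trans ?_
      gcongr
      rw [← ENNReal.ofReal_ofNat]
      exact ENNReal.ofReal_le_ofReal (by linarith)
  · refine ⟨fun ξ hξ => ?_, iSup₂_le fun ξ hξ => ?_⟩ <;>
      obtain ⟨k, hk0, hk, ⟨rfl, h1⟩ | ⟨hkpos, h1, h2⟩⟩ := great_circle_bound hn hf hm hξ
    · exact h1
    · exact ⟨h1, h2.trans_lt
        (ENNReal.mul_lt_top (ENNReal.mul_lt_top ENNReal.ofReal_lt_top hc.lt_top) hL)⟩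
    · simp [hk]
    · refine (enorm_smul_xrayTransform_le _ f ξ).trans ?_
      rw [hk, Real.enorm_of_nonneg hk0]
      calc _ ≤ ENNReal.ofReal k * (ENNReal.ofReal (4 * Real.pi / k) *
            sphereArea n ^ (-(1 / (n : ℝ))) * lorentzNorm f n 1 (surfaceMeasure n)) := by gcongr
        _ = _ := by
          rw [← mul_assoc, ← mul_assoc, ← ENNReal.ofReal_mul hk0, mul_div_cancel₀ _ hkpos.ne']
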